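/- There is an absolute constant $c>0$ such that the following holds for every finite field $\mathbb{F}$ (of any characteristic) and every $n\ge 0$. Let $f,g\in\mathbb{F}[x_1,\dots,x_n]$ be $$f=\prod_{1\le i<j\le n}(x_i+x_j+1),\qquad g=\prod_{i=1}^n(1-x_i)-1 .$$ Then the system $f=0,\ g=0,\ x_i^2-x_i=0\ (1\le i\le n)$ has no solution in $\mathbb{F}^n$, and every roABP-$\mathrm{IPS}_{\mathrm{LIN}'}$ refutation of it (roABP-lbIPS refutation), in any order of the variables, has size at least $\exp(cn)$. Here an lbIPS refutation of the system is a polynomial $C(\bar x,y_1,y_2,z_1,\dots,z_n)$ over $\mathbb{F}$ in $2n+2$ variables such that $C(\bar x,0,0,\bar 0)=0$ and $C(\bar x,f,g,x_1^2-x_1,\dots,x_n^2-x_n)=1$ as formal polynomials and $C$ has degree at most $1$ in $y_1$ and degree at most $1$ in $y_2$ (no degree restriction on $\bar x,\bar z$); it is a roABP-lbIPS refutation if $C$ is given by a read-once oblivious algebraic branching program (roABP) in the $N=2n+2$ variables $\bar x,\bar y,\bar z$. An algebraic branching program of depth $D$ has vertex layers $V_0,\dots,V_D$ with $V_0=\{s\}$,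 $V_D=\{t\}$, and edges from $V_{\ell-1}$ to $V_\ell$ labelled by polynomials; it computes the sum over all $s$–$t$ paths of the product of the edge labels. It is a roABP if $D=N$ and, for some order $v_1,\dots,v_N$ of the variables, the labels between $V_{\ell-1}$ and $V_\ell$ are univariate polynomials in $v_\ell$. Its size is $N\cdot r\cdot d\cdot D$, where $r=\max_\ell|V_\ell|$ is its width and $d$ is the maximum individual degree of an edge label. -/

import Mathlib

/-- An algebraic branching program over the field `F` in the variables `V`: a layered graph with
layers `0, …, depth`, where layer `ℓ` has `layerCard ℓ` vertices, the first layer consists of the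
source alone and the last one of the sink alone. Every vertex of a layer is joined to every vertex
of the next one by an edge labelled by a polynomial (a missing edge is an edge with label `0`). -/
structure ABP (F V : Type*) [Field F] where
  depth : ℕ
  layerCard : Fin (depth + 1) → ℕ
  source_unique : layerCard 0 = 1
  sink_unique : layerCard (Fin.last depth) = 1
  label : (ℓ : Fin depth) → Fin (layerCard ℓ.castSucc) → Fin (layerCard ℓ.succ) →
    MvPolynomial V F

namespace ABP

variable {F V : Type*} [Field F]

/-- The polynomial computed by the program: the sum over all source-sink paths of the product of
the labels along the path. A path picks one vertex in every layer. -/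
noncomputable def computes (A : ABP F V) : MvPolynomial V F :=
  ∑ p : ((ℓ : Fin (A.depth + 1)) → Fin (A.layerCard ℓ)),
    ∏ ℓ : Fin A.depth, A.label ℓ (p ℓ.castSucc) (p ℓ.succ)

/-- The width: the largest number of vertices in a layer. -/
def width (A : ABP F V) : ℕ :=
  Finset.univ.sup A.layerCard

/-- The individual degree: the largest degree of a variable in an edge label. -/
noncomputable def degree [Fintype V] (A : ABP F V) : ℕ :=
  Finset.univ.sup fun ℓ : Fin A.depth =>
    Finset.univ.sup fun u : Fin (A.layerCard ℓ.castSucc) =>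
      Finset.univ.sup fun v : Fin (A.layerCard ℓ.succ) =>
        Finset.univ.sup fun x : V => (A.label ℓ u v).degreeOf x

/-- The size: number of variables times width times individual degree times depth. -/
noncomputable def size [Fintype V] (A : ABP F V) : ℕ :=
  Fintype.card V * A.width * A.degree * A.depth

/-- `A` is a read-once oblivious ABP (roABP) in the variable order
`order 0 < order 1 < ⋯`: there is one layer of edges for every variable, and the labels of the
`ℓ`-th layer of edges are univariate polynomials in the variable `order ℓ`. -/
def IsReadOnceOblivious (A : ABP F V) (order : Fin A.depth ≃ V) : Prop :=
  ∀ ℓ u v, (A.label ℓ u v).vars ⊆ {order ℓ}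

end ABP

section IPS

variable {F σ ι : Type*} [Field F]

/-- `C(x, y, z)` is (the polynomial of) an Ideal Proof System refutation of the system
`f j = 0` (`j : ι`) together with the Boolean axioms `x i ^ 2 - x i = 0` (`i : σ`). The variables of
`C` are the `x i`, then one placeholder `y j` for each `f j`, then one placeholder `z i` for each
Boolean axiom. -/
def IsIPSRefutation (f : ι → MvPolynomial σ F) (C : MvPolynomial (σ ⊕ ι ⊕ σ) F) : Prop :=
  MvPolynomial.aeval
      (Sum.elim MvPolynomial.X (Sum.elim (fun _ => 0) (fun _ => 0)) :
        σ ⊕ ι ⊕ σ → MvPolynomial σ F) C = 0 ∧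
  MvPolynomial.aeval
      (Sum.elim MvPolynomial.X
        (Sum.elim f (fun i => MvPolynomial.X i ^ 2 - MvPolynomial.X i)) :
        σ ⊕ ι ⊕ σ → MvPolynomial σ F) C = 1

/-- An IPS refutation that has individual degree at most one in each of the placeholders `y j` of
the axioms `f j`; nothing is required of the placeholders of the Boolean axioms. -/
def IsLbIPSRefutation (f : ι → MvPolynomial σ F) (C : MvPolynomial (σ ⊕ ι ⊕ σ) F) : Prop :=
  IsIPSRefutation f C ∧ ∀ j : ι, C.degreeOf (Sum.inr (Sum.inl j)) ≤ 1

/-- The system `f j = 0` (`j : ι`), `x i ^ 2 - x i = 0` (`i : σ`) has no solution. -/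
def IsUnsatisfiableWithBoolean (f : ι → MvPolynomial σ F) : Prop :=
  ¬ ∃ a : σ → F, (∀ j, MvPolynomial.eval a (f j) = 0) ∧
    ∀ i, MvPolynomial.eval a (MvPolynomial.X i ^ 2 - MvPolynomial.X i) = 0

end IPS

/-- `∏_{i < j} (x_i + x_j + 1)`. -/
noncomputable def pairProduct (F : Type*) [Field F] (n : ℕ) : MvPolynomial (Fin n) F :=
  ∏ p : Fin n × Fin n with p.1 < p.2, (MvPolynomial.X p.1 + MvPolynomial.X p.2 + 1)

/-- `∏_i (1 - x_i) - 1`. -/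
noncomputable def complProductSubOne (F : Type*) [Field F] (n : ℕ) : MvPolynomial (Fin n) F :=
  (∏ i : Fin n, (1 - MvPolynomial.X i)) - 1

/-! Evaluate a refutation `C` at points `x` with coordinates in a polynomial ring over `F`, and set
`Φ(x) = 1 - C(x, 0, g(x), x² - x)`. Where `f(x) = 0`, the second refutation identity gives `Φ(x) =
0`. At the origin `g` vanishes, so the first identity gives `Φ(0) = 1`.

Choose disjoint sets of variables matched by `s i ↔ t i`. Let a subset `e` determine the values on
the `s`-side and a subset `d` those on the `t`-side, so that some matched pair has `x_i + x_j + 1 =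
0` unless `d ⊆ e`, while the point with `d = e` specializes to the origin. Then the matrix `Φ(x e
d)` is triangular with nonzero diagonal, and its rank is at least `2 ^ m`
(`two_pow_le_of_triangular`). Generic values make this independent of the field's size and
characteristic.

Conversely, `C` is affine in the placeholder of `g`, and `g + 1` is a product of univariate factors,
hence of rank one. So the rank of `Φ` is controlled by the two matrices with that placeholder fixed
at 0 and 1. For a roABP these have rank at most `width ^ #K` if `K` cuts separate the positions of
the two sides (`splitRankLE_aeval_computes`). Each side occupies positions of both `x` and `z`
variables; four halvings (`exists_cuts_separating`) yield four cuts in any order, at the cost of a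
constant factor in `m`. -/

section RoABPLowerBound

open Finset

/-! ### Split rank of matrices over a commutative ring -/

/-- A matrix (function of two arguments) that is the sum of at most `R` products of a function of
the first argument and a function of the second one. -/
def SplitRankLE {D E E' : Type*} [CommRing D] (R : ℕ) (M : E → E' → D) : Prop :=
  ∃ (k : ℕ) (a : Fin k → E → D) (b : Fin k → E' → D), k ≤ R ∧
    ∀ e d, M e d = ∑ i, a i e * b i d

namespace SplitRankLE

variable {D E E' : Type*} [CommRing D] {R R' : ℕ} {M M' : E → E' → D}

theorem of_fintype {κ : Type*} [Fintype κ] (hκ : Fintype.card κ ≤ R) (a : κ → E → D)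
    (b : κ → E' → D) (h : ∀ e d, M e d = ∑ i, a i e * b i d) : SplitRankLE R M := by
  refine ⟨Fintype.card κ, fun i => a ((Fintype.equivFin κ).symm i),
    fun i => b ((Fintype.equivFin κ).symm i), hκ, fun e d => ?_⟩
  rw [h]
  exact ((Fintype.equivFin κ).symm.sum_comp fun i => a i e * b i d).symm

theorem of_mul (a : E → D) (b : E' → D) (h : ∀ e d, M e d = a e * b d) : SplitRankLE 1 M :=
  of_fintype (κ := Unit) (by simp) (fun _ => a) (fun _ => b) (by simpa using h)

theorem add (h : SplitRankLE R M) (h' : SplitRankLE R' M') :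
    SplitRankLE (R + R') fun e d => M e d + M' e d := by
  obtain ⟨k, a, b, hk, h⟩ := h
  obtain ⟨k', a', b', hk', h'⟩ := h'
  refine of_fintype (κ := Fin k ⊕ Fin k') (by simp; omega) (Sum.elim a a') (Sum.elim b b') ?_
  intro e d
  simp [h, h']

theorem mul (h : SplitRankLE R M) (h' : SplitRankLE R' M') :
    SplitRankLE (R * R') fun e d => M e d * M' e d := by
  obtain ⟨k, a, b, hk, h⟩ := h
  obtain ⟨k', a', b', hk', h'⟩ := h'
  refine of_fintype (κ := Fin k × Fin k') (by simpa using Nat.mul_le_mul hk hk')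
    (fun i e => a i.1 e * a' i.2 e) (fun i d => b i.1 d * b' i.2 d) ?_
  intro e d
  simp only [h, h', Finset.sum_mul_sum, Fintype.sum_prod_type]
  exact Finset.sum_congr rfl fun i _ => Finset.sum_congr rfl fun j _ => by ring

/-- A triangular matrix indexed by subsets, with nonzero diagonal, has full split rank. -/
theorem two_pow_le_of_triangular [IsDomain D] {ι : Type*} [Fintype ι]
    {M : Finset ι → Finset ι → D} (hM : SplitRankLE R M)
    (htri : ∀ e d, ¬ d ⊆ e → M e d = 0) (hdiag : ∀ e, M e e ≠ 0) :
    2 ^ Fintype.card ι ≤ R := by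
  classical
  obtain ⟨k, a, b, hk, h⟩ := hM
  have hli : LinearIndependent D fun (e : Finset ι) (i : Fin k) => a i e := by
    rw [Fintype.linearIndependent_iff]
    intro c hc
    have key : ∀ d, ∑ e, c e * M e d = 0 := by
      intro d
      have h1 : ∀ i, ∑ e, c e * a i e = 0 := fun i => by simpa using congrFun hc i
      calc ∑ e, c e * M e d = ∑ i, (∑ e, c e * a i e) * b i d := by
            simp only [h, Finset.mul_sum, Finset.sum_mul]
            rw [Finset.sum_comm]
            exact Finset.sum_congr rfl fun i _ => Finset.sum_congr rfl fun j _ => by ring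
        _ = 0 := by simp [h1]
    by_contra! hne
    -- At a maximal `d` of the support of the relation, column `d` leaves only the term `c d * M d
    -- d`: any other contributing row would be a strictly larger member of the support.
    obtain ⟨d, hd⟩ := (Set.toFinite {e | c e ≠ 0}).exists_maximal hne
    have h2 := key d
    rw [Finset.sum_eq_single d] at h2
    · exact (mul_ne_zero hd.prop (hdiag d)) h2
    · intro e _ hed
      by_cases hce : c e = 0
      · simp [hce]
      · rw [htri e d, mul_zero]
        intro hde
        exact hed (le_antisymm (hd.le_of_ge hce hde) hde)
    · simp
  have := hli.fintype_card_le_finrank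
  simp at this
  omega

end SplitRankLE

/-! ### Separating two sets of positions by few cuts -/

section Separation

/-- Cut at a median of `α` on `S`. One side of the cut holds at least half of `T`; keep it together
with the opposite half of `S`. -/
theorem exists_cut_halving {ι : Type*} (α β : ι → ℕ) (hα : Function.Injective α)
    (k : ℕ) (S T : Finset ι) (hS : 2 * k ≤ #S) (hT : 2 * k ≤ #T) :
    ∃ S' ⊆ S, ∃ T' ⊆ T, k ≤ #S' ∧ k ≤ #T' ∧ ∃ c : ℕ,
      (∀ i ∈ S', ∀ j ∈ T', (α i < c ∧ c ≤ β j) ∨ (β j < c ∧ c ≤ α i)) := by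
  classical
  have hex : ∃ c, k ≤ #{i ∈ S | α i < c} := by
    refine ⟨S.sup α + 1, ?_⟩
    rw [Finset.filter_true_of_mem fun i hi => Nat.lt_succ_of_le (Finset.le_sup hi)]
    omega
  obtain ⟨c, hc, hmin⟩ : ∃ c, k ≤ #{i ∈ S | α i < c} ∧ k ≤ #{i ∈ S | ¬ α i < c} := by
    refine ⟨Nat.find hex, Nat.find_spec hex, ?_⟩
    have hsum := Finset.card_filter_add_card_filter_not (s := S) (fun i => α i < Nat.find hex)
    suffices #{i ∈ S | α i < Nat.find hex} ≤ k by omega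
    rcases hq : Nat.find hex with _ | q
    · simp
    · have h1 : #{i ∈ S | α i < q} < k := by
        have := Nat.find_min hex (m := q) (by omega)
        omega
      have h2 : #{i ∈ S | α i = q} ≤ 1 := by
        rw [Finset.card_le_one]
        intro i hi j hj
        simp only [Finset.mem_filter] at hi hj
        exact hα (hi.2.trans hj.2.symm)
      have h3 : ({i ∈ S | α i < q + 1} : Finset ι) ⊆ {i ∈ S | α i < q} ∪ {i ∈ S | α i = q} := by
        intro i
        simp only [Finset.mem_filter, Finset.mem_union]
        grind
      have := (Finset.card_le_card h3).trans (Finset.card_union_le _ _)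
      omega
  have hsum := Finset.card_filter_add_card_filter_not (s := T) (fun i => β i < c)
  by_cases hb : k ≤ #{i ∈ T | β i < c}
  · refine ⟨_, Finset.filter_subset _ _, _, Finset.filter_subset _ _, hmin, hb, c, ?_⟩
    simp only [Finset.mem_filter]
    grind
  · refine ⟨_, Finset.filter_subset _ _, {i ∈ T | ¬ β i < c}, Finset.filter_subset _ _, hc,
      by omega, c, ?_⟩
    simp only [Finset.mem_filter]
    grind

theorem exists_cuts_separating {ι : Type*} (m : ℕ) (l : List ((ι → ℕ) × (ι → ℕ)))
    (hl : ∀ p ∈ l, Function.Injective p.1) (S T : Finset ι)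
    (hS : 2 ^ l.length * m ≤ #S) (hT : 2 ^ l.length * m ≤ #T) :
    ∃ S' ⊆ S, ∃ T' ⊆ T, m ≤ #S' ∧ m ≤ #T' ∧ ∃ K : Finset ℕ, #K ≤ l.length ∧
      ∀ p ∈ l, ∀ i ∈ S', ∀ j ∈ T', ∃ c ∈ K,
        (p.1 i < c ∧ c ≤ p.2 j) ∨ (p.2 j < c ∧ c ≤ p.1 i) := by
  classical
  induction l generalizing S T with
  | nil => exact ⟨S, subset_rfl, T, subset_rfl, by simpa using hS, by simpa using hT, ∅, by simp⟩
  | cons p l ih =>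
    obtain ⟨S₁, hS₁, T₁, hT₁, hcS, hcT, c, hc⟩ := exists_cut_halving p.1 p.2 (hl p (by simp))
      (2 ^ l.length * m) S T (by rw [List.length_cons, pow_succ] at hS; linarith)
      (by rw [List.length_cons, pow_succ] at hT; linarith)
    obtain ⟨S₂, hS₂, T₂, hT₂, hmS, hmT, K, hK, h⟩ :=
      ih (fun q hq => hl q (by simp [hq])) S₁ T₁ hcS hcT
    refine ⟨S₂, hS₂.trans hS₁, T₂, hT₂.trans hT₁, hmS, hmT, insert c K,
      (Finset.card_insert_le _ _).trans (by simpa using hK), ?_⟩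
    intro q hq i hi j hj
    rcases List.mem_cons.1 hq with rfl | hq
    · exact ⟨c, by simp, hc i (hS₂ hi) j (hT₂ hj)⟩
    · obtain ⟨c', hc', h'⟩ := h q hq i hi j hj
      exact ⟨c', by simp [hc'], h'⟩

end Separation

/-! ### Rank of path sums in a layered graph -/

section LayeredPaths

variable {D E E' : Type*} [CommRing D]

/-- The sum, over all paths through the layers of sizes `c 0, …, c n` that end in the vertex `v` of
the last layer, of the product of the labels along the path. -/
def pathWeight {n : ℕ} (c : Fin (n + 1) → ℕ)
    (lab : (ℓ : Fin n) → Fin (c ℓ.castSucc) → Fin (c ℓ.succ) → D) (v : Fin (c (Fin.last n))) : D :=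
  ∑ p : ((i : Fin n) → Fin (c i.castSucc)), ∏ ℓ : Fin n,
    lab ℓ (Fin.snoc (α := fun i => Fin (c i)) p v ℓ.castSucc)
      (Fin.snoc (α := fun i => Fin (c i)) p v ℓ.succ)

theorem pathWeight_zero (c : Fin 1 → ℕ)
    (lab : (ℓ : Fin 0) → Fin (c ℓ.castSucc) → Fin (c ℓ.succ) → D) (v : Fin (c (Fin.last 0))) :
    pathWeight c lab v = 1 := by
  simp [pathWeight]

theorem pathWeight_succ {n : ℕ} (c : Fin (n + 2) → ℕ)
    (lab : (ℓ : Fin (n + 1)) → Fin (c ℓ.castSucc) → Fin (c ℓ.succ) → D)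
    (v : Fin (c (Fin.last (n + 1)))) :
    pathWeight c lab v = ∑ u : Fin (c (Fin.last n).castSucc),
      pathWeight (fun i => c i.castSucc) (fun ℓ => lab ℓ.castSucc) u * lab (Fin.last n) u v := by
  unfold pathWeight
  rw [← (Fin.snocEquiv fun i : Fin (n + 1) => Fin (c i.castSucc)).sum_comp,
    Fintype.sum_prod_type]
  refine Finset.sum_congr rfl fun u _ => ?_
  rw [Finset.sum_mul]
  refine Finset.sum_congr rfl fun p _ => ?_
  rw [Fin.prod_univ_castSucc]
  have hs : ∀ q : (i : Fin (n + 1)) → Fin (c i.castSucc), ∀ i : Fin (n + 1),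
      Fin.snoc (α := fun i => Fin (c i)) q v i.castSucc = q i := fun q i =>
    Fin.snoc_castSucc (α := fun i => Fin (c i)) (x := v) (p := q) i
  congr 1
  · refine Finset.prod_congr rfl fun ℓ _ => ?_
    exact congrArg₂ (lab ℓ.castSucc) (hs _ _) (hs _ ℓ.succ)
  · refine congrArg₂ (lab (Fin.last n)) ((hs _ _).trans ?_) ?_
    · exact Fin.snoc_last (α := fun i : Fin (n + 1) => Fin (c i.castSucc)) (x := u) (p := p)
    · exact Fin.snoc_last (α := fun i => Fin (c i)) (x := v) (p := _)

theorem sum_path_eq_sum_pathWeight {n : ℕ} (c : Fin (n + 1) → ℕ)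
    (lab : (ℓ : Fin n) → Fin (c ℓ.castSucc) → Fin (c ℓ.succ) → D) :
    ∑ p : ((i : Fin (n + 1)) → Fin (c i)), ∏ ℓ : Fin n, lab ℓ (p ℓ.castSucc) (p ℓ.succ) =
      ∑ v, pathWeight c lab v := by
  rw [← (Fin.snocEquiv fun i : Fin (n + 1) => Fin (c i)).sum_comp, Fintype.sum_prod_type]
  rfl

/-- A family of matrices, all of split rank at most `R` with common right factors. -/
def HasLeftForm {V : Type*} (R : ℕ) (W : V → E → E' → D) : Prop :=
  ∃ (k : ℕ) (a : Fin k → V → E → D) (b : Fin k → E' → D), k ≤ R ∧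
    ∀ v e d, W v e d = ∑ i, a i v e * b i d

namespace HasLeftForm

theorem mono {V : Type*} {R R' : ℕ} {W : V → E → E' → D} (h : HasLeftForm R W) (hR : R ≤ R') :
    HasLeftForm R' W := by
  obtain ⟨k, a, b, hk, h⟩ := h
  exact ⟨k, a, b, hk.trans hR, h⟩

/-- Labels that depend on the first argument only are absorbed into the left factors, so the rank
bound does not grow. -/
theorem step {V V' : Type*} [Fintype V] {R : ℕ} {W : V → E → E' → D} (h : HasLeftForm R W)
    {W' : V' → E → E' → D} (lab : V → V' → E → D)
    (hW' : ∀ v e d, W' v e d = ∑ u, W u e d * lab u v e) : HasLeftForm R W' := by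
  obtain ⟨k, a, b, hk, h⟩ := h
  refine ⟨k, fun i v e => ∑ u, a i u e * lab u v e, b, hk, fun v e d => ?_⟩
  simp only [hW', h, Finset.sum_mul]
  rw [Finset.sum_comm]
  exact Finset.sum_congr rfl fun i _ => Finset.sum_congr rfl fun j _ => by ring

/-- Exchanging the roles of the arguments makes every old left factor `a i u`, one for each vertex
`u`, a common factor; the vertex dependence becomes an indicator. This costs a factor of the layer
size. -/
theorem swap {s R r : ℕ} (hs : s ≤ r) {W : Fin s → E → E' → D} (h : HasLeftForm R W) :
    HasLeftForm (R * r) fun v d e => W v e d := by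
  classical
  obtain ⟨k, a, b, hk, h⟩ := h
  refine ⟨Fintype.card (Fin k × Fin s),
    fun i v d => b ((Fintype.equivFin _).symm i).1 d *
      if v = ((Fintype.equivFin (Fin k × Fin s)).symm i).2 then 1 else 0,
    fun i e => a ((Fintype.equivFin _).symm i).1 ((Fintype.equivFin (Fin k × Fin s)).symm i).2 e,
    by simpa using Nat.mul_le_mul hk hs, fun v e d => ?_⟩
  show W v d e = _
  rw [h, (Fintype.equivFin (Fin k × Fin s)).symm.sum_comp
    fun j => (b j.1 e * if v = j.2 then 1 else 0) * a j.1 j.2 d, Fintype.sum_prod_type]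
  simp [mul_comm]

theorem splitRankLE_sum {V : Type*} [Fintype V] {R : ℕ} {W : V → E → E' → D}
    (h : HasLeftForm R W) : SplitRankLE R fun e d => ∑ v, W v e d := by
  obtain ⟨k, a, b, hk, h⟩ := h
  refine ⟨k, fun i e => ∑ v, a i v e, b, hk, fun e d => ?_⟩
  simp only [h, Finset.sum_mul]
  exact Finset.sum_comm

end HasLeftForm

theorem SplitRankLE.swap {R : ℕ} {M : E → E' → D} (h : SplitRankLE R fun d e => M e d) :
    SplitRankLE R M := by
  obtain ⟨k, a, b, hk, h⟩ := h
  exact ⟨k, b, a, hk, fun e d => by simp [h, mul_comm]⟩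

/-- Here `cnt ℓ` numbers the block of layer `ℓ`, and `side` tells which argument the labels of a
block may depend on. Within a block `step` applies freely; `swap` is needed only when the side
changes, and then `cnt` has grown and pays for the factor `r`. -/
theorem hasLeftForm_pathWeight {r : ℕ} (hr : 1 ≤ r) (cnt : ℕ → ℕ) (hcnt : Monotone cnt)
    (side : ℕ → Bool) (n : ℕ) (c : Fin (n + 1) → ℕ) (hc : ∀ i, c i ≤ r)
    (lab : (ℓ : Fin n) → Fin (c ℓ.castSucc) → Fin (c ℓ.succ) → E → E' → D)
    (hleft : ∀ ℓ : Fin n, side (cnt ℓ) = true → ∀ u v e d d', lab ℓ u v e d = lab ℓ u v e d')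
    (hright : ∀ ℓ : Fin n, side (cnt ℓ) = false → ∀ u v e e' d, lab ℓ u v e d = lab ℓ u v e' d) :
    (side (cnt n) = true → HasLeftForm (r ^ cnt n)
      fun v (e : E) (d : E') => pathWeight c (fun ℓ u v => lab ℓ u v e d) v) ∧
    (side (cnt n) = false → HasLeftForm (r ^ cnt n)
      fun v (d : E') (e : E) => pathWeight c (fun ℓ u v => lab ℓ u v e d) v) := by
  induction n with
  | zero =>
    simp only [pathWeight_zero]
    exact ⟨fun _ => ⟨1, fun _ _ _ => 1, fun _ _ => 1, Nat.one_le_pow _ _ hr, by simp⟩,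
      fun _ => ⟨1, fun _ _ _ => 1, fun _ _ => 1, Nat.one_le_pow _ _ hr, by simp⟩⟩
  | succ n ih =>
    have IH := ih (fun i => c i.castSucc) (fun i => hc _) (fun ℓ => lab ℓ.castSucc)
      (fun ℓ => hleft ℓ.castSucc) (fun ℓ => hright ℓ.castSucc)
    simp only [pathWeight_succ]
    have hle : cnt n ≤ cnt (n + 1) := hcnt (Nat.le_succ n)
    have hpow : r ^ cnt n ≤ r ^ cnt (n + 1) := Nat.pow_le_pow_right hr hle
    have hpow' : cnt n ≠ cnt (n + 1) → r ^ cnt n * r ≤ r ^ cnt (n + 1) := fun hne => by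
      rw [← pow_succ]
      exact Nat.pow_le_pow_right hr (by omega)
    -- Sample arguments `e₀`, `d₀` are needed to write a label as a function of the other argument
    -- alone.
    rcases isEmpty_or_nonempty E with hE | ⟨⟨e₀⟩⟩
    · exact ⟨fun _ => ⟨0, fun i => i.elim0, fun i => i.elim0, by simp, fun _ e => hE.elim e⟩,
        fun _ => ⟨0, fun i => i.elim0, fun i => i.elim0, by simp, fun _ _ e => hE.elim e⟩⟩
    rcases isEmpty_or_nonempty E' with hE' | ⟨⟨d₀⟩⟩
    · exact ⟨fun _ => ⟨0, fun i => i.elim0, fun i => i.elim0, by simp, fun _ _ e => hE'.elim e⟩,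
        fun _ => ⟨0, fun i => i.elim0, fun i => i.elim0, by simp, fun _ e => hE'.elim e⟩⟩
    rcases hside : side (cnt n) with _ | _
    · have h := (IH.2 hside).step (fun u v d => lab (Fin.last n) u v e₀ d)
        (W' := fun v (d : E') (e : E) => ∑ u : Fin (c (Fin.last n).castSucc),
          pathWeight (fun i => c i.castSucc) (fun ℓ u v => lab ℓ.castSucc u v e d) u *
            lab (Fin.last n) u v e d) fun v d e => Finset.sum_congr rfl fun u _ => by
          rw [hright (Fin.last n) hside u v e e₀ d]
      refine ⟨fun h1 => ?_, fun _ => h.mono hpow⟩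
      exact (h.swap (hc _)).mono (hpow' fun heq => by rw [heq] at hside; simp_all)
    · have h := (IH.1 hside).step (fun u v e => lab (Fin.last n) u v e d₀)
        (W' := fun v (e : E) (d : E') => ∑ u : Fin (c (Fin.last n).castSucc),
          pathWeight (fun i => c i.castSucc) (fun ℓ u v => lab ℓ.castSucc u v e d) u *
            lab (Fin.last n) u v e d) fun v e d => Finset.sum_congr rfl fun u _ => by
          rw [hleft (Fin.last n) hside u v e d d₀]
      refine ⟨fun _ => h.mono hpow, fun h1 => ?_⟩
      exact (h.swap (hc _)).mono (hpow' fun heq => by rw [heq] at hside; simp_all)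

end LayeredPaths

/-! ### Evaluations of read-once oblivious programs -/

namespace ABP

variable {F V : Type*} [Field F]

theorem layerCard_le_width (A : ABP F V) (i : Fin (A.depth + 1)) : A.layerCard i ≤ A.width :=
  Finset.le_sup (f := A.layerCard) (Finset.mem_univ i)

theorem one_le_width (A : ABP F V) : 1 ≤ A.width :=
  A.source_unique ▸ A.layerCard_le_width 0

theorem aeval_computes {D : Type*} [CommRing D] [Algebra F D] (A : ABP F V) (w : V → D) :
    MvPolynomial.aeval w A.computes =
      ∑ p : ((ℓ : Fin (A.depth + 1)) → Fin (A.layerCard ℓ)),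
        ∏ ℓ : Fin A.depth, MvPolynomial.aeval w (A.label ℓ (p ℓ.castSucc) (p ℓ.succ)) := by
  simp [computes, map_sum, map_prod]

theorem aeval_label_congr {D : Type*} [CommRing D] [Algebra F D] {A : ABP F V}
    {order : Fin A.depth ≃ V} (hA : A.IsReadOnceOblivious order) {w w' : V → D} (ℓ u v)
    (h : w (order ℓ) = w' (order ℓ)) :
    MvPolynomial.aeval w (A.label ℓ u v) = MvPolynomial.aeval w' (A.label ℓ u v) := by
  refine MvPolynomial.eval₂Hom_congr' rfl (fun x hx _ => ?_) rfl
  rw [Finset.mem_singleton.1 (hA ℓ u v hx)]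
  exact h

/-- If the positions of the variables whose value depends on the first argument are separated by
`K` from those of the variables whose value depends on the second one, then the values of a roABP
form a matrix of split rank at most `width ^ #K`. -/
theorem splitRankLE_aeval_computes {D E E' : Type*} [CommRing D] [Algebra F D] {A : ABP F V}
    {order : Fin A.depth ≃ V} (hA : A.IsReadOnceOblivious order) (w : E → E' → V → D)
    (P Q : Fin A.depth → Prop)
    (hP : ∀ ℓ, ¬ P ℓ → ∀ e e' d, w e d (order ℓ) = w e' d (order ℓ))
    (hQ : ∀ ℓ, ¬ Q ℓ → ∀ e d d', w e d (order ℓ) = w e d' (order ℓ))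
    (K : Finset ℕ)
    (hK : ∀ i j : Fin A.depth, P i → Q j → ∃ c ∈ K,
      ((i : ℕ) < c ∧ c ≤ (j : ℕ)) ∨ ((j : ℕ) < c ∧ c ≤ (i : ℕ))) :
    SplitRankLE (A.width ^ #K) fun e d => MvPolynomial.aeval (w e d) A.computes := by
  classical
  set cnt : ℕ → ℕ := fun ℓ => #{c ∈ K | c ≤ ℓ} with hcnt
  have hmono : Monotone cnt := fun a b hab => Finset.card_le_card fun c => by
    simp only [Finset.mem_filter]
    grind
  have hlt : ∀ i j c : ℕ, c ∈ K → i < c → c ≤ j → cnt i < cnt j := by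
    intro i j c hc hic hcj
    refine Finset.card_lt_card (Finset.ssubset_iff_of_subset (fun c => ?_) |>.2 ⟨c, ?_, ?_⟩)
    · simp only [Finset.mem_filter]
      grind
    · simp [hc, hcj]
    · simp only [Finset.mem_filter]
      grind
  have hne : ∀ i j : Fin A.depth, P i → Q j → cnt i ≠ cnt j := by
    intro i j hi hj
    obtain ⟨c, hc, h | h⟩ := hK i j hi hj
    · exact (hlt _ _ c hc h.1 h.2).ne
    · exact (hlt _ _ c hc h.1 h.2).ne'
  -- A block between consecutive cuts gets side `true` if it contains a position in `P`; by `hne` it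
  -- then contains none in `Q`.
  set side : ℕ → Bool := fun q => decide (∃ i : Fin A.depth, P i ∧ cnt i = q) with hside
  have hform := hasLeftForm_pathWeight A.one_le_width cnt hmono side A.depth A.layerCard
    A.layerCard_le_width (fun ℓ u v e d => MvPolynomial.aeval (w e d) (A.label ℓ u v))
    (fun ℓ h u v e d d' => aeval_label_congr hA ℓ u v <| hQ ℓ (fun hq => by
      obtain ⟨i, hi, hi'⟩ := of_decide_eq_true h
      exact hne i ℓ hi hq hi') e d d')
    (fun ℓ h u v e e' d => aeval_label_congr hA ℓ u v <| hP ℓ (fun hp =>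
      of_decide_eq_false h ⟨ℓ, hp, rfl⟩) e e' d)
  have hR : A.width ^ cnt A.depth ≤ A.width ^ #K :=
    Nat.pow_le_pow_right A.one_le_width (Finset.card_filter_le _ _)
  have hsum : ∀ e d, MvPolynomial.aeval (w e d) A.computes = ∑ v, pathWeight A.layerCard
      (fun ℓ u v => MvPolynomial.aeval (w e d) (A.label ℓ u v)) v := fun e d =>
    (A.aeval_computes (w e d)).trans (sum_path_eq_sum_pathWeight A.layerCard
      fun ℓ u v => MvPolynomial.aeval (w e d) (A.label ℓ u v))
  simp only [hsum]
  rcases hb : side (cnt A.depth) with _ | _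
  · exact ((hform.2 hb).mono hR).splitRankLE_sum.swap
  · exact ((hform.1 hb).mono hR).splitRankLE_sum

/-- Rules out individual degree 0, for which the size would be 0 whatever the width. -/
theorem aeval_computes_eq_of_degree_eq_zero [Fintype V] {D : Type*} [CommRing D] [Algebra F D]
    {A : ABP F V} (hA : A.degree = 0) (w w' : V → D) :
    MvPolynomial.aeval w A.computes = MvPolynomial.aeval w' A.computes := by
  rw [aeval_computes, aeval_computes]
  refine Finset.sum_congr rfl fun p _ => Finset.prod_congr rfl fun ℓ _ => ?_
  refine MvPolynomial.eval₂Hom_congr' rfl (fun x hx _ => ?_) rfl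
  simp only [degree, ← Nat.bot_eq_zero, Finset.sup_eq_bot_iff] at hA
  have h0 := hA ℓ (Finset.mem_univ _) (p ℓ.castSucc) (Finset.mem_univ _) (p ℓ.succ)
    (Finset.mem_univ _) x (Finset.mem_univ _)
  rw [MvPolynomial.mem_vars_iff_mem_support] at hx
  obtain ⟨s, hs, hxs⟩ := hx
  have := MvPolynomial.degreeOf_le_iff.1 h0.le s hs
  simp only [Nat.bot_eq_zero] at this
  simp_all

end ABP

namespace MvPolynomial

/-- A polynomial of degree at most one in a variable is affine in it. -/
theorem aeval_update_of_degreeOf_le_one {R V D : Type*} [CommRing R] [CommRing D] [Algebra R D]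
    [Fintype V] [DecidableEq V] {p : MvPolynomial V R} {x : V} (hp : p.degreeOf x ≤ 1) (w : V → D)
    (y : D) :
    aeval (Function.update w x y) p =
      (1 - y) * aeval (Function.update w x 0) p + y * aeval (Function.update w x 1) p := by
  simp only [aeval_def, eval₂_eq', Finset.mul_sum, ← Finset.sum_add_distrib]
  refine Finset.sum_congr rfl fun s hs => ?_
  have hprod : ∀ t : D, ∏ i, Function.update w x t i ^ s i =
      t ^ s x * ∏ i ∈ Finset.univ.erase x, w i ^ s i := fun t => by
    rw [← Finset.mul_prod_erase _ _ (Finset.mem_univ x), Function.update_self]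
    congr 1
    refine Finset.prod_congr rfl fun i hi => ?_
    rw [Function.update_of_ne (Finset.ne_of_mem_erase hi)]
  rw [hprod, hprod, hprod]
  have h1 : s x ≤ 1 := degreeOf_le_iff.1 hp s hs
  interval_cases s x <;> ring

end MvPolynomial

/-! ### Refutations evaluated in `F`-algebras -/

section LowerBound

variable {F : Type*} [Field F] {m n : ℕ}

theorem isUnsatisfiableWithBoolean_pairProduct (F : Type*) [Field F] (n : ℕ) :
    IsUnsatisfiableWithBoolean ![pairProduct F n, complProductSubOne F n] := by
  rintro ⟨a, ha, hb⟩
  have hf := ha 0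
  have hg := ha 1
  have ha0 : ∀ i, a i = 0 := by
    intro i
    have h1 : a i * (a i - 1) = 0 := by
      have := hb i
      simp only [map_sub, map_pow, MvPolynomial.eval_X] at this
      linear_combination this
    rcases mul_eq_zero.1 h1 with h | h
    · exact h
    · exfalso
      have hz : ∏ j, (1 - a j) = 0 :=
        Finset.prod_eq_zero (Finset.mem_univ i) (by linear_combination -h)
      simp [complProductSubOne, hz] at hg
  simp [pairProduct, ha0] at hf

/-- The assignment to the variables of an IPS refutation of two axioms that is induced by an
assignment `x` to the original variables, with values `0` and `y` for the two placeholders. -/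
def ipsAssignment {D : Type*} [CommRing D] (x : Fin n → D) (y : D) : Fin n ⊕ Fin 2 ⊕ Fin n → D :=
  Sum.elim x (Sum.elim ![0, y] fun j => x j ^ 2 - x j)

theorem ipsAssignment_eq_update {D : Type*} [CommRing D] (x : Fin n → D) (y : D) :
    ipsAssignment x y =
      Function.update (ipsAssignment x 0) (Sum.inr (Sum.inl 1)) y := by
  funext v
  rcases v with j | k | j
  · simp [ipsAssignment]
  · fin_cases k
    · simp [ipsAssignment, Function.update]
    · simp [ipsAssignment]
  · simp [ipsAssignment]

theorem aeval_pairProduct {D : Type*} [CommRing D] [Algebra F D] (x : Fin n → D) :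
    MvPolynomial.aeval x (pairProduct F n) =
      ∏ p : Fin n × Fin n with p.1 < p.2, (x p.1 + x p.2 + 1) := by
  simp [pairProduct, map_prod]

theorem aeval_complProductSubOne {D : Type*} [CommRing D] [Algebra F D] (x : Fin n → D) :
    MvPolynomial.aeval x (complProductSubOne F n) = ∏ i, (1 - x i) - 1 := by
  simp [complProductSubOne, map_prod]

theorem aeval_pairProduct_eq_zero {D : Type*} [CommRing D] [Algebra F D] {x : Fin n → D}
    {i j : Fin n} (hij : i ≠ j) (h : x i + x j + 1 = 0) :
    MvPolynomial.aeval x (pairProduct F n) = 0 := by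
  rw [aeval_pairProduct]
  rcases lt_or_gt_of_ne hij with hlt | hlt
  · exact Finset.prod_eq_zero (i := (i, j)) (by simpa using hlt) h
  · exact Finset.prod_eq_zero (i := (j, i)) (by simpa using hlt) (by linear_combination h)

theorem IsIPSRefutation.aeval_eq_one {C : MvPolynomial (Fin n ⊕ Fin 2 ⊕ Fin n) F}
    {f g : MvPolynomial (Fin n) F} (hC : IsIPSRefutation ![f, g] C) {D : Type*} [CommRing D]
    [Algebra F D] {x : Fin n → D} (hx : MvPolynomial.aeval x f = 0) :
    MvPolynomial.aeval (ipsAssignment x (MvPolynomial.aeval x g)) C = 1 := by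
  have h := congrArg (MvPolynomial.aeval x) hC.2
  rw [MvPolynomial.comp_aeval_apply, map_one] at h
  rw [← h]
  congr 2
  funext v
  rcases v with j | k | j
  · simp [ipsAssignment]
  · fin_cases k <;> simp [ipsAssignment, hx]
  · simp [ipsAssignment]

theorem IsIPSRefutation.aeval_zero {C : MvPolynomial (Fin n ⊕ Fin 2 ⊕ Fin n) F}
    {f : Fin 2 → MvPolynomial (Fin n) F} (hC : IsIPSRefutation f C) :
    MvPolynomial.aeval (0 : Fin n ⊕ Fin 2 ⊕ Fin n → F) C = 0 := by
  have h := congrArg (MvPolynomial.aeval (0 : Fin n → F)) hC.1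
  rw [MvPolynomial.comp_aeval_apply, map_zero] at h
  refine Eq.trans ?_ h
  congr 2
  funext v
  rcases v with j | k | j <;> simp

/-! ### The triangular family of points on a matching -/

open MvPolynomial in
/-- The generic values of the variables on the first side of the matching `s i ↔ t i`. -/
noncomputable def matchingLeft (F : Type*) [Field F] (s : Fin m → Fin n) (e : Finset (Fin m)) :
    Fin n → MvPolynomial (Fin m × Fin 3) F :=
  Function.extend s (fun i => if i ∈ e then X (i, 1) else X (i, 0)) 0

open MvPolynomial in
/-- The generic values of the variables on the second side of the matching `s i ↔ t i`. -/
noncomputable def matchingRight (F : Type*) [Field F] (t : Fin m → Fin n) (d : Finset (Fin m)) :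
    Fin n → MvPolynomial (Fin m × Fin 3) F :=
  Function.extend t (fun i => if i ∈ d then -1 - X (i, 0) else X (i, 2)) 0

theorem matchingLeft_of_forall_ne {s : Fin m → Fin n} {j : Fin n} (hj : ∀ i, s i ≠ j)
    (e : Finset (Fin m)) : matchingLeft F s e j = 0 :=
  Function.extend_apply' _ _ _ (by simpa using hj)

theorem matchingRight_of_forall_ne {t : Fin m → Fin n} {j : Fin n} (hj : ∀ i, t i ≠ j)
    (d : Finset (Fin m)) : matchingRight F t d j = 0 :=
  Function.extend_apply' _ _ _ (by simpa using hj)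

theorem matchingLeft_apply {s : Fin m → Fin n} (hs : Function.Injective s) (e : Finset (Fin m))
    (i : Fin m) : matchingLeft F s e (s i) =
      if i ∈ e then MvPolynomial.X (i, 1) else MvPolynomial.X (i, 0) :=
  hs.extend_apply _ _ _

theorem matchingRight_apply {t : Fin m → Fin n} (ht : Function.Injective t) (d : Finset (Fin m))
    (i : Fin m) : matchingRight F t d (t i) =
      if i ∈ d then -1 - MvPolynomial.X (i, 0) else MvPolynomial.X (i, 2) :=
  ht.extend_apply _ _ _

/-- The values of all the variables: those outside of the matching are set to zero. -/
noncomputable def matchingPoint (F : Type*) [Field F] (s t : Fin m → Fin n)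
    (e d : Finset (Fin m)) : Fin n → MvPolynomial (Fin m × Fin 3) F :=
  matchingLeft F s e + matchingRight F t d

/-- For `i ∈ d \ e` the matched values are `X (i, 0)` and `-1 - X (i, 0)`, which kill the factor of
that pair. -/
theorem aeval_pairProduct_matchingPoint {s t : Fin m → Fin n} (hs : Function.Injective s)
    (ht : Function.Injective t) (hst : ∀ i j, s i ≠ t j) {e d : Finset (Fin m)} (hde : ¬ d ⊆ e) :
    MvPolynomial.aeval (matchingPoint F s t e d) (pairProduct F n) = 0 := by
  obtain ⟨i, hid, hie⟩ := Finset.not_subset.1 hde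
  refine aeval_pairProduct_eq_zero (hst i i) ?_
  simp only [matchingPoint, Pi.add_apply, matchingLeft_apply hs, matchingRight_apply ht,
    matchingLeft_of_forall_ne (fun j => hst j i),
    matchingRight_of_forall_ne (fun j => (hst i j).symm), hid, hie, if_true, if_false]
  ring

/-- The diagonal points specialize to the origin. -/
theorem exists_algHom_matchingPoint_eq_zero {s t : Fin m → Fin n} (hs : Function.Injective s)
    (ht : Function.Injective t) (hst : ∀ i j, s i ≠ t j) (e : Finset (Fin m)) :
    ∃ ψ : MvPolynomial (Fin m × Fin 3) F →ₐ[F] F, ∀ j, ψ (matchingPoint F s t e e j) = 0 := by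
  -- Only the values `-1 - X (i, 0)` with `i ∈ e` need `X (i, 0) = -1`; for such `i` the left value
  -- is `X (i, 1)`, which is free to be 0.
  refine ⟨MvPolynomial.aeval fun p => if p.1 ∈ e ∧ p.2 = 0 then -1 else 0, fun j => ?_⟩
  simp only [matchingPoint, Pi.add_apply]
  by_cases hjs : ∃ i, s i = j
  · obtain ⟨i, rfl⟩ := hjs
    rw [matchingLeft_apply hs, matchingRight_of_forall_ne (fun j => (hst i j).symm)]
    by_cases hi : i ∈ e <;> simp [hi]
  · rw [matchingLeft_of_forall_ne (by simpa using hjs)]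
    by_cases hjt : ∃ i, t i = j
    · obtain ⟨i, rfl⟩ := hjt
      rw [matchingRight_apply ht]
      by_cases hi : i ∈ e <;> simp [hi]
    · rw [matchingRight_of_forall_ne (by simpa using hjt)]
      simp

/-- Each variable receives a nonzero value from at most one side, so `1 - (l + r) = (1 - l) * (1 -
r)`. -/
theorem splitRankLE_prod_one_sub_matchingPoint {s t : Fin m → Fin n}
    (hst : ∀ i j, s i ≠ t j) :
    SplitRankLE 1 fun e d => ∏ j, (1 - matchingPoint F s t e d j) := by
  refine SplitRankLE.of_mul (fun e => ∏ j, (1 - matchingLeft F s e j))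
    (fun d => ∏ j, (1 - matchingRight F t d j)) fun e d => ?_
  rw [← Finset.prod_mul_distrib]
  refine Finset.prod_congr rfl fun j _ => ?_
  have h : matchingLeft F s e j * matchingRight F t d j = 0 := by
    by_cases hj : ∃ i, s i = j
    · obtain ⟨i, rfl⟩ := hj
      rw [matchingRight_of_forall_ne (fun j => (hst i j).symm), mul_zero]
    · rw [matchingLeft_of_forall_ne (by simpa using hj), zero_mul]
  simp only [matchingPoint, Pi.add_apply]
  linear_combination -h

theorem splitRankLE_aeval_ipsAssignment {A : ABP F (Fin n ⊕ Fin 2 ⊕ Fin n)}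
    {order : Fin A.depth ≃ Fin n ⊕ Fin 2 ⊕ Fin n} (hA : A.IsReadOnceOblivious order)
    {s t : Fin m → Fin n} {K : Finset ℕ}
    (hK : ∀ p q : Fin n → Fin n ⊕ Fin 2 ⊕ Fin n,
      (p = Sum.inl ∨ p = fun j => Sum.inr (Sum.inr j)) →
      (q = Sum.inl ∨ q = fun j => Sum.inr (Sum.inr j)) →
      ∀ i j, ∃ c ∈ K,
        ((order.symm (p (s i)) : ℕ) < c ∧ c ≤ (order.symm (q (t j)) : ℕ)) ∨
        ((order.symm (q (t j)) : ℕ) < c ∧ c ≤ (order.symm (p (s i)) : ℕ)))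
    (y : MvPolynomial (Fin m × Fin 3) F) :
    SplitRankLE (A.width ^ #K) fun e d =>
      MvPolynomial.aeval (ipsAssignment (matchingPoint F s t e d) y) A.computes := by
  refine ABP.splitRankLE_aeval_computes hA _
    (fun ℓ => ∃ i, order ℓ = Sum.inl (s i) ∨ order ℓ = Sum.inr (Sum.inr (s i)))
    (fun ℓ => ∃ i, order ℓ = Sum.inl (t i) ∨ order ℓ = Sum.inr (Sum.inr (t i)))
    ?_ ?_ K ?_
  · intro ℓ hℓ e e' d
    push Not at hℓ
    have h0 : ∀ j, (order ℓ = Sum.inl j ∨ order ℓ = Sum.inr (Sum.inr j)) →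
        matchingPoint F s t e d j = matchingPoint F s t e' d j := by
      intro j hj
      have : ∀ i, s i ≠ j := by
        rintro i rfl
        exact hj.elim (hℓ i).1 (hℓ i).2
      simp [matchingPoint, matchingLeft_of_forall_ne this]
    rcases hv : order ℓ with j | k | j
    · simp [ipsAssignment, h0 j (Or.inl hv)]
    · simp [ipsAssignment]
    · simp [ipsAssignment, h0 j (Or.inr hv)]
  · intro ℓ hℓ e d d'
    push Not at hℓ
    have h0 : ∀ j, (order ℓ = Sum.inl j ∨ order ℓ = Sum.inr (Sum.inr j)) →
        matchingPoint F s t e d j = matchingPoint F s t e d' j := by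
      intro j hj
      have : ∀ i, t i ≠ j := by
        rintro i rfl
        exact hj.elim (hℓ i).1 (hℓ i).2
      simp [matchingPoint, matchingRight_of_forall_ne this]
    rcases hv : order ℓ with j | k | j
    · simp [ipsAssignment, h0 j (Or.inl hv)]
    · simp [ipsAssignment]
    · simp [ipsAssignment, h0 j (Or.inr hv)]
  · rintro a b ⟨i, hi⟩ ⟨j, hj⟩
    have hp : ∃ p : Fin n → Fin n ⊕ Fin 2 ⊕ Fin n,
        (p = Sum.inl ∨ p = fun j => Sum.inr (Sum.inr j)) ∧ order.symm (p (s i)) = a := by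
      rcases hi with hi | hi
      · exact ⟨_, Or.inl rfl, by simp [← hi]⟩
      · exact ⟨_, Or.inr rfl, by simp [← hi]⟩
    have hq : ∃ q : Fin n → Fin n ⊕ Fin 2 ⊕ Fin n,
        (q = Sum.inl ∨ q = fun j => Sum.inr (Sum.inr j)) ∧ order.symm (q (t j)) = b := by
      rcases hj with hj | hj
      · exact ⟨_, Or.inl rfl, by simp [← hj]⟩
      · exact ⟨_, Or.inr rfl, by simp [← hj]⟩
    obtain ⟨p, hp, rfl⟩ := hp
    obtain ⟨q, hq, rfl⟩ := hq
    exact hK p q hp hq i j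

/-- A roABP-lbIPS refutation is wide if a long matching of the variables is separated by few
cuts. -/
theorem two_pow_le_of_separated_matching {A : ABP F (Fin n ⊕ Fin 2 ⊕ Fin n)}
    {order : Fin A.depth ≃ Fin n ⊕ Fin 2 ⊕ Fin n} (hA : A.IsReadOnceOblivious order)
    (hC : IsLbIPSRefutation ![pairProduct F n, complProductSubOne F n] A.computes)
    {s t : Fin m → Fin n} (hs : Function.Injective s) (ht : Function.Injective t)
    (hst : ∀ i j, s i ≠ t j) {K : Finset ℕ}
    (hK : ∀ p q : Fin n → Fin n ⊕ Fin 2 ⊕ Fin n,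
      (p = Sum.inl ∨ p = fun j => Sum.inr (Sum.inr j)) →
      (q = Sum.inl ∨ q = fun j => Sum.inr (Sum.inr j)) →
      ∀ i j, ∃ c ∈ K,
        ((order.symm (p (s i)) : ℕ) < c ∧ c ≤ (order.symm (q (t j)) : ℕ)) ∨
        ((order.symm (q (t j)) : ℕ) < c ∧ c ≤ (order.symm (p (s i)) : ℕ))) :
    2 ^ m ≤ 1 + 4 * A.width ^ #K := by
  set x := matchingPoint F s t
  set G : Finset (Fin m) → Finset (Fin m) → MvPolynomial (Fin m × Fin 3) F :=
    fun e d => ∏ j, (1 - x e d j) with hG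
  have hG1 : SplitRankLE 1 G := splitRankLE_prod_one_sub_matchingPoint hst
  have hconst : ∀ a : MvPolynomial (Fin m × Fin 3) F,
      SplitRankLE 1 fun _ _ : Finset (Fin m) => a := fun a =>
    SplitRankLE.of_mul (fun _ => a) (fun _ => 1) (by simp)
  have hC0 := splitRankLE_aeval_ipsAssignment hA hK 0
  have hC1 := splitRankLE_aeval_ipsAssignment hA hK 1
  have hrank : SplitRankLE (1 + 4 * A.width ^ #K) fun e d =>
      1 - MvPolynomial.aeval (ipsAssignment (x e d)
        (MvPolynomial.aeval (x e d) (complProductSubOne F n))) A.computes := by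
    -- With `g = G - 1`, affinity gives `1 + (-2 + G) * C₀ + (1 - G) * C₁`, of rank at most `1 + 2w
    -- + 2w` with `w = width ^ #K`.
    have h := ((hconst 1).add ((((hconst (-2)).add hG1).mul hC0))).add
      (((hconst 1).add ((hconst (-1)).mul hG1)).mul hC1)
    convert h using 1
    · ring
    · funext e d
      rw [ipsAssignment_eq_update, MvPolynomial.aeval_update_of_degreeOf_le_one (hC.2 1),
        ← ipsAssignment_eq_update, ← ipsAssignment_eq_update, aeval_complProductSubOne]
      simp only [hG]
      ring
  have h := hrank.two_pow_le_of_triangular ?_ ?_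
  · simpa using h
  · intro e d hde
    rw [hC.1.aeval_eq_one (aeval_pairProduct_matchingPoint hs ht hst hde), sub_self]
  · intro e h0
    obtain ⟨ψ, hψ⟩ := exists_algHom_matchingPoint_eq_zero (F := F) hs ht hst e
    have h1 := congrArg ψ h0
    rw [map_sub, map_one, map_zero, MvPolynomial.comp_aeval_apply] at h1
    have hw : (fun v => ψ (ipsAssignment (x e e)
        (MvPolynomial.aeval (x e e) (complProductSubOne F n)) v)) = 0 := by
      funext v
      rcases v with j | k | j
      · simpa [ipsAssignment] using hψ j
      · fin_cases k
        · simp [ipsAssignment]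
        · show ψ (MvPolynomial.aeval (x e e) (complProductSubOne F n)) = 0
          rw [aeval_complProductSubOne]
          simp [map_prod, x, hψ]
      · simp [ipsAssignment, x, hψ j]
    rw [hw, hC.1.aeval_zero] at h1
    simp at h1

theorem two_pow_le_width_of_lbIPS {A : ABP F (Fin n ⊕ Fin 2 ⊕ Fin n)}
    {order : Fin A.depth ≃ Fin n ⊕ Fin 2 ⊕ Fin n} (hA : A.IsReadOnceOblivious order)
    (hC : IsLbIPSRefutation ![pairProduct F n, complProductSubOne F n] A.computes)
    (hm : 32 * m ≤ n) : 2 ^ m ≤ 1 + 4 * A.width ^ 4 := by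
  -- Four halvings, one for each pair of `x`- or `z`-positions, shrink both sides by `2 ^ 4 = 16`;
  -- two sides of `16 * m` variables require `32 * m ≤ n`.
  obtain ⟨S₀, -, hS₀⟩ := Finset.exists_subset_card_eq (s := (Finset.univ : Finset (Fin n)))
    (n := 16 * m) (by simp; omega)
  have hT₀ : #S₀ᶜ = n - 16 * m := by rw [Finset.card_compl, hS₀, Fintype.card_fin]
  set px : Fin n → ℕ := fun j => order.symm (Sum.inl j) with hpx
  set pz : Fin n → ℕ := fun j => order.symm (Sum.inr (Sum.inr j)) with hpz
  have hpxi : Function.Injective px := fun i j h => by simpa [hpx, Fin.val_inj] using h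
  have hpzi : Function.Injective pz := fun i j h => by simpa [hpz, Fin.val_inj] using h
  obtain ⟨S, hS, T, hT, hmS, hmT, K, hK, hsep⟩ := exists_cuts_separating m
    [(px, px), (px, pz), (pz, px), (pz, pz)] (by simp [hpxi, hpzi]) S₀ S₀ᶜ
    (by simp [hS₀]) (by simp only [List.length_cons, List.length_nil, hT₀]; omega)
  let s : Fin m → Fin n := fun i => S.orderEmbOfCardLe hmS i
  let t : Fin m → Fin n := fun i => T.orderEmbOfCardLe hmT i
  have hsS : ∀ i, s i ∈ S := fun i => Finset.orderEmbOfCardLe_mem S hmS i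
  have htT : ∀ i, t i ∈ T := fun i => Finset.orderEmbOfCardLe_mem T hmT i
  have h := two_pow_le_of_separated_matching hA hC (s := s) (t := t) (K := K)
    (S.orderEmbOfCardLe hmS).injective (T.orderEmbOfCardLe hmT).injective
    (fun i j h => by
      have h1 := hS (hsS i)
      have h2 := hT (htT j)
      rw [← h] at h2
      simp_all) ?_
  · refine h.trans ?_
    gcongr
    · exact A.one_le_width
    · exact hK
  · rintro p q (rfl | rfl) (rfl | rfl) i j
    · exact hsep (px, px) (by simp) _ (hsS i) _ (htT j)
    · exact hsep (px, pz) (by simp) _ (hsS i) _ (htT j)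
    · exact hsep (pz, px) (by simp) _ (hsS i) _ (htT j)
    · exact hsep (pz, pz) (by simp) _ (hsS i) _ (htT j)

theorem degree_ne_zero_of_lbIPS {A : ABP F (Fin n ⊕ Fin 2 ⊕ Fin n)}
    {f : Fin 2 → MvPolynomial (Fin n) F} (hC : IsIPSRefutation f A.computes) : A.degree ≠ 0 := by
  intro h
  have := (hC.1.symm.trans (A.aeval_computes_eq_of_degree_eq_zero h _ _)).trans hC.2
  exact zero_ne_one this

theorem two_pow_le_size_pow_of_lbIPS {A : ABP F (Fin n ⊕ Fin 2 ⊕ Fin n)}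
    {order : Fin A.depth ≃ Fin n ⊕ Fin 2 ⊕ Fin n} (hA : A.IsReadOnceOblivious order)
    (hC : IsLbIPSRefutation ![pairProduct F n, complProductSubOne F n] A.computes) :
    2 ^ (n / 32 + 1) ≤ A.size ^ 4 := by
  have h := two_pow_le_width_of_lbIPS hA hC (m := n / 32) (by omega)
  have hd := Nat.one_le_iff_ne_zero.2 (degree_ne_zero_of_lbIPS hC.1)
  have hw : 1 ≤ A.width ^ 4 := Nat.one_le_pow _ _ A.one_le_width
  have hN : Fintype.card (Fin n ⊕ Fin 2 ⊕ Fin n) = 2 * n + 2 := by simp; ring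
  have hD : A.depth = 2 * n + 2 := by
    rw [← hN, ← Fintype.card_congr order, Fintype.card_fin]
  have hsize : 2 * A.width ≤ A.size := by
    calc 2 * A.width = 2 * A.width * 1 * 1 := by ring
      _ ≤ Fintype.card (Fin n ⊕ Fin 2 ⊕ Fin n) * A.width * A.degree * A.depth := by
        gcongr <;> omega
  -- Since `1 ≤ width ^ 4`, doubling `1 + 4 * width ^ 4` stays below `16 * width ^ 4`.
  calc 2 ^ (n / 32 + 1) ≤ (2 * A.width) ^ 4 := by rw [pow_succ, mul_pow]; omega
    _ ≤ A.size ^ 4 := Nat.pow_le_pow_left hsize 4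

end LowerBound

end RoABPLowerBound

theorem mainTheorem4 :
    ∃ c : ℝ, 0 < c ∧
      ∀ (F : Type*) [Field F] [Finite F] (n : ℕ),
        IsUnsatisfiableWithBoolean ![pairProduct F n, complProductSubOne F n] ∧
        ∀ (A : ABP F (Fin n ⊕ Fin 2 ⊕ Fin n)) (order : Fin A.depth ≃ Fin n ⊕ Fin 2 ⊕ Fin n),
          A.IsReadOnceOblivious order →
          IsLbIPSRefutation ![pairProduct F n, complProductSubOne F n] A.computes →
          Real.exp (c * n) ≤ (A.size : ℝ) := by
  -- The constant is 128 = 32 * 4: 32 from the length of the matching, 4 from the four cuts.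
  refine ⟨Real.log 2 / 128, by positivity, fun F _ _ n =>
    ⟨isUnsatisfiableWithBoolean_pairProduct F n, fun A order hA hC => ?_⟩⟩
  have h := two_pow_le_size_pow_of_lbIPS hA hC
  have h' : (2 : ℝ) ^ (n / 32 + 1) ≤ (A.size : ℝ) ^ 4 := by exact_mod_cast h
  refine le_of_pow_le_pow_left₀ (n := 4) (by norm_num) (by positivity) (le_trans ?_ h')
  have hn : (n : ℝ) ≤ 32 * ((n / 32 + 1 : ℕ) : ℝ) := by
    exact_mod_cast (by omega : n ≤ 32 * (n / 32 + 1))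
  rw [← Real.exp_nat_mul, ← Real.rpow_natCast 2, Real.rpow_def_of_pos (by norm_num)]
  refine Real.exp_le_exp.2 ?_
  have hlog : 0 < Real.log 2 := Real.log_pos (by norm_num)
  have := mul_le_mul_of_nonneg_left hn hlog.le
  push_cast at this ⊢
  linarith
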